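/- Let $k\ge 2$ and $n\ge 2^k$, and let $C$ be a cycle on $2^k$ vertices contained as a subgraph in the complete graph $K_n$. Let $G$ be the unweighted graph on the $n$ vertices of $K_n$ obtained by removing all edges of $C$ from $K_n$. Let $M$ be any one of the adjacency matrix $A$, the Laplacian matrix $L=\Delta-A$, or the signless Laplacian matrix $Q=\Delta+A$ of $G$, where $\Delta$ is the diagonal matrix of vertex degrees, and put $U(t)=\exp(\mathrm{i}tM)$ for $t\in\mathbb{R}$. Let $\{a,c\}$ and $\{b,d\}$ be pairs of antipodal vertices of $C$ (i.e., vertices whose distance in $C$ equals the diameter of $C$), with $a\neq b$. Then $G$ has pretty good state transfer relative to $M$ between the unit vectors $\frac{1}{\sqrt2}(\mathbf e_a-\mathbf e_b)$ and $\frac{1}{\sqrt2}(\mathbf e_c-\mathbf e_d)$; that is, there exist a sequence $(t_j)$ of real numbers and $\gamma\in\mathbb{C}$ with $|\gamma|=1$ such that $$\lim_{j\to\infty}U(t_j)\,\tfrac{1}{\sqrt2}(\mathbf e_a-\mathbf e_b)=\gamma\,\tfrac{1}{\sqrt2}(\mathbf e_c-\mathbf e_d).$$ -/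

import Mathlib

/-- The three standard Hamiltonians of a continuous-time quantum walk on a graph. -/
inductive HamiltonianType
  | adjacency
  | laplacian
  | signlessLaplacian

/-- The matrix `M(G)` of an unweighted graph: `A`, `L = Δ - A` or `Q = Δ + A`. -/
noncomputable def hamiltonian {V : Type*} [Fintype V] [DecidableEq V]
    (m : HamiltonianType) (G : SimpleGraph V) : Matrix V V ℝ :=
  open Classical in
  match m with
  | .adjacency => G.adjMatrix ℝ
  | .laplacian => G.degMatrix ℝ - G.adjMatrix ℝ
  | .signlessLaplacian => G.degMatrix ℝ + G.adjMatrix ℝ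

/-- The transition matrix `U(t) = exp(i t M)`. -/
noncomputable def transitionMatrix {V : Type*} [Fintype V] [DecidableEq V]
    (M : Matrix V V ℝ) (t : ℝ) : Matrix V V ℂ :=
  NormedSpace.exp ((Complex.I * (t : ℂ)) • M.map (fun r : ℝ => (r : ℂ)))

/-- A real pure state is given by a real vector of Euclidean norm one. -/
def IsRealPureState {V : Type*} [Fintype V] (x : V → ℝ) : Prop :=
  ∑ v, x v ^ 2 = 1

/-- Pretty good state transfer between the real pure states `x` and `y` relative to `M`:
`U(t_k) x → γ y` for some real sequence `t_k` and some phase factor `γ`. -/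
def PrettyGoodStateTransfer {V : Type*} [Fintype V] [DecidableEq V]
    (M : Matrix V V ℝ) (x y : V → ℝ) : Prop :=
  IsRealPureState x ∧ IsRealPureState y ∧
    ∃ (t : ℕ → ℝ) (γ : ℂ), ‖γ‖ = 1 ∧
      Filter.Tendsto
        (fun k => (transitionMatrix M (t k)).mulVec (fun v => (x v : ℂ)))
        Filter.atTop (nhds (γ • fun v => (y v : ℂ)))

/-- The vector `(e_a - e_b) / √2`. -/
noncomputable def pairState {V : Type*} [DecidableEq V] (a b : V) : V → ℝ :=
  (1 / Real.sqrt 2) • (Pi.single a 1 - Pi.single b 1)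

/-- Two vertices are antipodal if their distance is the diameter of the graph. -/
def IsAntipodal {V : Type*} (G : SimpleGraph V) (u v : V) : Prop :=
  G.dist u v = G.diam

/-- The graph obtained from `K_n` by removing all edges of a copy of the cycle `C_N` in it. -/
def completeMinusCycle {N n : ℕ}
    (φ : SimpleGraph.Copy (SimpleGraph.cycleGraph N) (⊤ : SimpleGraph (Fin n))) :
    SimpleGraph (Fin n) :=
  (⊤ : SimpleGraph (Fin n)).deleteEdges φ.toSubgraph.edgeSet

/-! Write `N = 2 ^ k`. A vector supported on `C` with entries of sum zero is killed by the all-ones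
matrix, so there the adjacency matrix of `G` acts as `-I - A(C)`. All degrees on `C` equal `n - 3`,
so each Hamiltonian acts as `α ± A(C)`. The difference `e_a - e_b` is therefore a combination of the
nontrivial characters of `ℤ/N`, whose eigenvalues for `A(C)` are `θ_r = 2 cos (2πr/N)`.

Moving to the antipode multiplies the `r`-th Fourier coefficient by `(-1)^r`. It thus suffices to
find times at which `exp (i t θ_r)` tends to `η (-1)^r` for all `r`, with one common sign `η`; the
phase `exp (i t α)` converges along a subsequence by compactness.

Such times come from Kronecker's theorem. Since `ζ = exp (2πi/N)` has degree `N/2` over `ℚ`, the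
`θ_r` with `0 ≤ r < N/4` are independent over `ℤ`. The others are `0`, negatives or repetitions of
these, and the required signs respect these relations (`exists_tendsto_exp_two_mul_cos`). -/

/-! ### Kronecker's theorem by mean values -/

open Filter Topology in
/-- The mean over `[0, T]` of the character `t ↦ exp (i μ t)` tends to `1` if `μ = 0`, and to `0`
otherwise. -/
theorem tendsto_mean_exp_mul_I (μ : ℝ) :
    Tendsto (fun T : ℝ => (T : ℂ)⁻¹ * ∫ t in (0 : ℝ)..T, Complex.exp (Complex.I * μ * t))
      atTop (𝓝 (if μ = 0 then 1 else 0)) := by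
  split_ifs with h
  · subst h
    refine tendsto_const_nhds.congr' ?_
    filter_upwards [eventually_gt_atTop 0] with T hT
    have : (T : ℂ) ≠ 0 := by exact_mod_cast hT.ne'
    simp [this]
  · have hc : Complex.I * (μ : ℂ) ≠ 0 := by simp [h]
    have hT : Tendsto (fun T : ℝ => T⁻¹ * (2 / |μ|)) atTop (𝓝 0) := by
      simpa using tendsto_inv_atTop_zero.mul_const (2 / |μ|)
    refine squeeze_zero_norm' ?_ hT
    filter_upwards [eventually_gt_atTop 0] with T hT
    rw [integral_exp_mul_complex hc, norm_mul, norm_div, norm_mul, norm_inv]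
    have h1 : ‖Complex.exp (Complex.I * μ * T)‖ = 1 := by
      have := Complex.norm_exp_ofReal_mul_I (μ * T)
      rw [← this]; congr 2; push_cast; ring
    have h2 : ‖Complex.exp (Complex.I * μ * (0 : ℝ))‖ = 1 := by simp
    have h3 := norm_sub_le (Complex.exp (Complex.I * μ * T)) (Complex.exp (Complex.I * μ * (0 : ℝ)))
    rw [h1, h2] at h3
    simp only [Complex.norm_real, Complex.norm_I, one_mul, Real.norm_eq_abs, abs_of_pos hT]
    gcongr
    linarith

/-- The Fourier expansion of a power of `(1 + cos x) / 2`. -/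
theorem one_add_cos_div_two_pow (x : ℝ) (p : ℕ) :
    (((1 + Real.cos x) / 2 : ℝ) : ℂ) ^ p =
      ∑ l ∈ Finset.range (2 * p + 1),
        (((2 * p).choose l : ℂ) / 4 ^ p) * Complex.exp (Complex.I * (((l : ℤ) - p : ℤ) : ℂ) * x) := by
  -- The square turns the `p`-th power into a binomial expansion of exponent `2 * p`, recentred at
  -- frequency zero.
  have key : (((1 + Real.cos x) / 2 : ℝ) : ℂ) =
      (Complex.exp (Complex.I * x) + 1) ^ 2 * Complex.exp (-(Complex.I * x)) / 4 := by
    have h0 : Complex.exp (Complex.I * x) * Complex.exp (-(Complex.I * x)) = 1 := by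
      rw [← Complex.exp_add]; simp
    push_cast
    rw [Complex.cos, mul_comm (x : ℂ) Complex.I, show -(x : ℂ) * Complex.I = -(Complex.I * x) by ring]
    linear_combination (-(Complex.exp (Complex.I * x)) / 4 - 1 / 2) * h0
  rw [key, div_pow, mul_pow, ← pow_mul, add_pow, Finset.sum_mul, Finset.sum_div]
  refine Finset.sum_congr rfl fun l _ => ?_
  rw [← Complex.exp_nat_mul, ← Complex.exp_nat_mul, one_pow]
  have : Complex.exp (Complex.I * (((l : ℤ) - p : ℤ) : ℂ) * x) =
      Complex.exp (l * (Complex.I * x)) * Complex.exp (p * -(Complex.I * x)) := by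
    rw [← Complex.exp_add]; congr 1; push_cast; ring
  rw [this]; ring

open Filter Topology in
/-- The mean value of a power of the kernel `∏ (1 + cos) / 2` attached to linearly independent
frequencies. -/
theorem tendsto_mean_prod_one_add_cos {ι : Type*} [Fintype ι] {θ : ι → ℝ}
    (hθ : LinearIndependent ℤ θ) (α : ι → ℝ) (p : ℕ) :
    Tendsto (fun T : ℝ => (T : ℂ)⁻¹ * ∫ t in (0 : ℝ)..T,
        (∏ i, (((1 + Real.cos (t * θ i - α i)) / 2 : ℝ) : ℂ)) ^ p)
      atTop (𝓝 (((p.centralBinom : ℂ) / 4 ^ p) ^ Fintype.card ι)) := by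
  classical
  set F : Finset (ι → ℕ) := Fintype.piFinset fun _ => Finset.range (2 * p + 1) with hF
  let w : (ι → ℕ) → ℂ := fun f => ∏ i, ((((2 * p).choose (f i) : ℂ) / 4 ^ p) *
    Complex.exp (-(Complex.I * (((f i : ℤ) - p : ℤ) : ℂ) * α i)))
  let μ : (ι → ℕ) → ℝ := fun f => ∑ i, (((f i : ℤ) - p : ℤ) : ℝ) * θ i
  have hexp : ∀ t : ℝ, (∏ i, (((1 + Real.cos (t * θ i - α i)) / 2 : ℝ) : ℂ)) ^ p =
      ∑ f ∈ F, w f * Complex.exp (Complex.I * μ f * t) := by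
    intro t
    rw [← Finset.prod_pow]
    simp_rw [one_add_cos_div_two_pow]
    rw [Finset.prod_univ_sum]
    refine Finset.sum_congr rfl fun f _ => ?_
    have : Complex.exp (Complex.I * μ f * t) =
        ∏ i, Complex.exp (Complex.I * (((f i : ℤ) - p : ℤ) : ℂ) * (θ i * t)) := by
      rw [← Complex.exp_sum]
      congr 1
      simp only [μ]
      push_cast
      rw [Finset.mul_sum, Finset.sum_mul]
      exact Finset.sum_congr rfl fun i _ => by ring
    rw [this, ← Finset.prod_mul_distrib]
    refine Finset.prod_congr rfl fun i _ => ?_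
    rw [mul_assoc _ (Complex.exp _) (Complex.exp _), ← Complex.exp_add]
    congr 2
    push_cast
    ring
  -- Independence leaves a single term of frequency zero, the product of the central coefficients;
  -- every other term has mean zero.
  have hμ : ∀ f, μ f = 0 ↔ f = fun _ => p := by
    intro f
    constructor
    · intro h
      have h' := Fintype.linearIndependent_iff.1 hθ (fun i => (f i : ℤ) - p)
        (by simpa only [zsmul_eq_mul] using h)
      funext i
      have := h' i
      omega
    · rintro rfl
      simp [μ]
  have hint : ∀ T : ℝ, (T : ℂ)⁻¹ * ∫ t in (0 : ℝ)..T,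
        (∏ i, (((1 + Real.cos (t * θ i - α i)) / 2 : ℝ) : ℂ)) ^ p =
      ∑ f ∈ F, w f * ((T : ℂ)⁻¹ * ∫ t in (0 : ℝ)..T, Complex.exp (Complex.I * μ f * t)) := by
    intro T
    simp_rw [hexp]
    rw [intervalIntegral.integral_finsetSum, Finset.mul_sum]
    · refine Finset.sum_congr rfl fun f _ => ?_
      rw [intervalIntegral.integral_const_mul]
      ring
    · intro f _
      apply Continuous.intervalIntegrable
      fun_prop
  simp_rw [hint]
  have hlim := tendsto_finsetSum F fun f _ => (tendsto_mean_exp_mul_I (μ f)).const_mul (w f)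
  convert hlim using 2
  rw [Finset.sum_eq_single (fun _ => p)]
  · rw [if_pos ((hμ _).2 rfl)]
    simp [w, Nat.centralBinom, div_pow]
  · intro f _ hf
    rw [if_neg (fun h => hf ((hμ f).1 h)), mul_zero]
  · intro h
    exact absurd (by simp [hF]; omega) h

open Filter Topology in
/-- **Kronecker's approximation theorem** (continuous form): if the frequencies `θ i` are linearly
independent over `ℤ`, then the angles `t * θ i` simultaneously come arbitrarily close to any
prescribed angles modulo `2π`. -/
theorem exists_forall_one_sub_lt_cos {ι : Type*} [Fintype ι] {θ : ι → ℝ}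
    (hθ : LinearIndependent ℤ θ) (α : ι → ℝ) {δ : ℝ} (hδ : 0 < δ) :
    ∃ t : ℝ, ∀ i, 1 - δ < Real.cos (t * θ i - α i) := by
  by_contra! hcon
  -- `q` is the value of `(1 + x) / 2` at `x = 1 - δ`. A bad index at every time keeps the whole
  -- kernel below `q`, so its `p`-th power has mean at most `q ^ p`.
  set q : ℝ := 1 - δ / 2 with hq
  have hfac : ∀ (t : ℝ) i, 0 ≤ (1 + Real.cos (t * θ i - α i)) / 2 ∧
      (1 + Real.cos (t * θ i - α i)) / 2 ≤ 1 := fun t i =>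
    ⟨by linarith [Real.neg_one_le_cos (t * θ i - α i)], by linarith [Real.cos_le_one (t * θ i - α i)]⟩
  have hq0 : 0 ≤ q := by
    obtain ⟨i, hi⟩ := hcon 0
    have := (hfac 0 i).1
    linarith
  have hq1 : q < 1 := by linarith
  have hle : ∀ t : ℝ, ∏ i, (1 + Real.cos (t * θ i - α i)) / 2 ≤ q := by
    intro t
    obtain ⟨i, hi⟩ := hcon t
    classical
    rw [← Finset.mul_prod_erase _ _ (Finset.mem_univ i)]
    refine (mul_le_of_le_one_right (hfac t i).1
      (Finset.prod_le_one (fun j _ => (hfac t j).1) fun j _ => (hfac t j).2)).trans ?_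
    linarith
  have hbound : ∀ p : ℕ, ((p.centralBinom : ℝ) / 4 ^ p) ^ Fintype.card ι ≤ q ^ p := by
    intro p
    have h := (tendsto_mean_prod_one_add_cos hθ α p).norm
    have h' : ‖((p.centralBinom : ℂ) / 4 ^ p) ^ Fintype.card ι‖ =
        ((p.centralBinom : ℝ) / 4 ^ p) ^ Fintype.card ι := by
      simp
    rw [h'] at h
    refine le_of_tendsto h ?_
    filter_upwards [eventually_gt_atTop 0] with T hT
    have hb := intervalIntegral.norm_integral_le_of_norm_le_const (a := (0 : ℝ)) (b := T)
      (C := q ^ p)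
      (f := fun t : ℝ => (∏ i, (((1 + Real.cos (t * θ i - α i)) / 2 : ℝ) : ℂ)) ^ p) (by
        intro t _
        rw [norm_pow, ← Complex.ofReal_prod, Complex.norm_real, Real.norm_eq_abs,
          abs_of_nonneg (Finset.prod_nonneg fun i _ => (hfac t i).1)]
        exact pow_le_pow_left₀ (Finset.prod_nonneg fun i _ => (hfac t i).1) (hle t) p)
    rw [norm_mul, norm_inv, Complex.norm_real, Real.norm_eq_abs, abs_of_pos hT,
      inv_mul_le_iff₀ hT]
    rw [sub_zero, abs_of_pos hT] at hb
    linarith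
  -- The exact mean decays only polynomially in `p`, which contradicts the geometric bound.
  have hlow : ∀ p : ℕ, (1 : ℝ) ≤ ((2 * p + 1 : ℕ) : ℝ) ^ Fintype.card ι * q ^ p := by
    intro p
    have h4 : (4 : ℝ) ^ p ≤ ((2 * p + 1 : ℕ) : ℝ) * p.centralBinom := by
      have := Nat.four_pow_le_two_mul_add_one_mul_central_binom p
      exact_mod_cast this
    have h1 : (1 : ℝ) ≤ ((2 * p + 1 : ℕ) : ℝ) * ((p.centralBinom : ℝ) / 4 ^ p) := by
      rw [← mul_div_assoc, one_le_div (by positivity)]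
      exact h4
    calc (1 : ℝ) ≤ (((2 * p + 1 : ℕ) : ℝ) * ((p.centralBinom : ℝ) / 4 ^ p)) ^ Fintype.card ι :=
          one_le_pow₀ h1
      _ = ((2 * p + 1 : ℕ) : ℝ) ^ Fintype.card ι *
          ((p.centralBinom : ℝ) / 4 ^ p) ^ Fintype.card ι := mul_pow _ _ _
      _ ≤ _ := by gcongr; exact hbound p
  -- The 3 comes from `2 * p + 1 ≤ 3 * p` for `p ≥ 1`.
  have hz : Tendsto (fun p : ℕ => (3 : ℝ) ^ Fintype.card ι *
      ((p : ℝ) ^ Fintype.card ι * q ^ p)) atTop (𝓝 0) := by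
    simpa using (tendsto_pow_const_mul_const_pow_of_abs_lt_one (Fintype.card ι)
      (by rwa [abs_of_nonneg hq0])).const_mul ((3 : ℝ) ^ Fintype.card ι)
  have : (1 : ℝ) ≤ 0 := by
    refine ge_of_tendsto hz ?_
    filter_upwards [eventually_ge_atTop 1] with p hp
    refine (hlow p).trans ?_
    rw [← mul_assoc, ← mul_pow]
    gcongr
    have : (1 : ℝ) ≤ p := by exact_mod_cast hp
    push_cast
    linarith
  linarith

open Filter Topology in
/-- Kronecker's approximation theorem, in terms of a sequence of times. -/
theorem exists_tendsto_exp_of_linearIndependent {ι : Type*} [Fintype ι] {θ : ι → ℝ}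
    (hθ : LinearIndependent ℤ θ) (α : ι → ℝ) :
    ∃ t : ℕ → ℝ, ∀ i, Tendsto (fun j => Complex.exp (Complex.I * (t j * θ i : ℝ))) atTop
      (𝓝 (Complex.exp (Complex.I * α i))) := by
  choose t ht using fun j : ℕ =>
    exists_forall_one_sub_lt_cos hθ α (δ := 1 / ((j : ℝ) + 1)) (by positivity)
  refine ⟨t, fun i => ?_⟩
  have hcos : Tendsto (fun j => Real.cos (t j * θ i - α i)) atTop (𝓝 1) := by
    refine tendsto_of_tendsto_of_tendsto_of_le_of_le (g := fun j : ℕ => 1 - 1 / ((j : ℝ) + 1))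
      (h := fun _ => 1) ?_ tendsto_const_nhds (fun j => (ht j i).le) fun j => Real.cos_le_one _
    simpa using (tendsto_one_div_add_atTop_nhds_zero_nat (𝕜 := ℝ)).const_sub 1
  rw [tendsto_iff_norm_sub_tendsto_zero]
  have hnorm : ∀ x y : ℝ, ‖Complex.exp (Complex.I * x) - Complex.exp (Complex.I * y)‖ =
      Real.sqrt (2 * (1 - Real.cos (x - y))) := by
    intro x y
    rw [eq_comm, Real.sqrt_eq_iff_mul_self_eq (by linarith [Real.cos_le_one (x - y)])
      (norm_nonneg _), ← sq, ← Complex.normSq_eq_norm_sq, mul_comm Complex.I, mul_comm Complex.I,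
      Complex.exp_mul_I, Complex.exp_mul_I, ← Complex.ofReal_cos, ← Complex.ofReal_sin,
      ← Complex.ofReal_cos, ← Complex.ofReal_sin, Complex.normSq_apply, Real.cos_sub]
    simp [-Complex.ofReal_cos, -Complex.ofReal_sin]
    nlinarith [Real.sin_sq_add_cos_sq x, Real.sin_sq_add_cos_sq y]
  simp_rw [hnorm]
  have := ((hcos.const_sub 1).const_mul 2).sqrt
  simpa using this

/-! ### Eigenvalues of the cycle of length `2 ^ (j + 2)` -/

/-- The numbers `2 cos (2π r / 2 ^ (j + 2))`, `0 ≤ r < 2 ^ j`, are linearly independent over `ℤ`. -/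
theorem linearIndependent_two_mul_cos (j : ℕ) :
    LinearIndependent ℤ
      (fun r : Fin (2 ^ j) => 2 * Real.cos (2 * Real.pi * (r : ℕ) / (2 ^ (j + 2) : ℕ))) := by
  rw [Fintype.linearIndependent_iff]
  set M := 2 ^ j with hM
  intro l hl
  have hM0 : 0 < M := by positivity
  set N := 2 ^ (j + 2) with hN
  have hN0 : N ≠ 0 := by positivity
  set ζ : ℂ := Complex.exp (2 * Real.pi * Complex.I / N) with hζ
  have hprim : IsPrimitiveRoot ζ N := Complex.isPrimitiveRoot_exp N hN0
  -- The relation in `ζ ^ r + ζ ^ (-r)`, multiplied by `ζ ^ (M - 1)` to clear negative exponents.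
  -- Its degree is below `2 * M`, the degree of the cyclotomic polynomial.
  let P : Polynomial ℤ := ∑ r : Fin M, Polynomial.C (l r) *
    (Polynomial.X ^ (M - 1 + r) + Polynomial.X ^ (M - 1 - r))
  have hcos : ∀ r : Fin M, ζ ^ (M - 1 + r : ℕ) + ζ ^ (M - 1 - r : ℕ) =
      ζ ^ (M - 1) * ((2 * Real.cos (2 * Real.pi * (r : ℕ) / N) : ℝ) : ℂ) := by
    intro r
    have h1 : ζ ^ (M - 1) = ζ ^ (M - 1 - r : ℕ) * ζ ^ (r : ℕ) := by
      rw [← pow_add]; congr 1; omega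
    have h2 : (2 * Real.cos (2 * Real.pi * (r : ℕ) / N) : ℝ) =
        ζ ^ (r : ℕ) + (ζ ^ (r : ℕ))⁻¹ := by
      push_cast
      rw [Complex.two_cos, hζ, ← Complex.exp_nat_mul, ← Complex.exp_neg]
      congr 2 <;> ring
    have h3 : ζ ^ (r : ℕ) ≠ 0 := pow_ne_zero _ (hprim.ne_zero hN0)
    rw [h2, pow_add, mul_add, h1, mul_inv_cancel_right₀ h3]
  have hP : Polynomial.aeval ζ P = 0 := by
    have : Polynomial.aeval ζ P = ζ ^ (M - 1) *
        ((∑ r : Fin M, l r • (2 * Real.cos (2 * Real.pi * (r : ℕ) / N)) : ℝ) : ℂ) := by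
      simp only [P, map_sum, map_mul, Polynomial.aeval_C, map_add, map_pow, Polynomial.aeval_X,
        hcos]
      push_cast
      rw [Finset.mul_sum]
      refine Finset.sum_congr rfl fun r _ => ?_
      simp only [zsmul_eq_mul, eq_intCast]
      ring
    rw [this, hl]
    simp
  have hdvd : Polynomial.cyclotomic N ℤ ∣ P := by
    rw [Polynomial.cyclotomic_eq_minpoly hprim (Nat.pos_of_ne_zero hN0)]
    exact minpoly.isIntegrallyClosed_dvd (hprim.isIntegral (Nat.pos_of_ne_zero hN0)) hP
  have hdeg : P.natDegree < (Polynomial.cyclotomic N ℤ).natDegree := by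
    have htot : N.totient = 2 * M := by
      rw [hN, Nat.totient_prime_pow_succ Nat.prime_two, hM, pow_succ]; ring
    rw [Polynomial.natDegree_cyclotomic, htot]
    refine lt_of_le_of_lt (b := 2 * M - 1) ?_ (by omega)
    refine Polynomial.natDegree_sum_le_of_forall_le _ _ fun r _ => ?_
    refine (Polynomial.natDegree_C_mul_le _ _).trans ?_
    refine (Polynomial.natDegree_add_le _ _).trans ?_
    rw [Polynomial.natDegree_X_pow, Polynomial.natDegree_X_pow]
    have := r.2
    omega
  have hP0 : P = 0 := Polynomial.eq_zero_of_dvd_of_natDegree_lt hdvd hdeg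
  intro s
  have hc : P.coeff (M - 1 + s) = 0 := by rw [hP0, Polynomial.coeff_zero]
  simp only [P, Polynomial.finsetSum_coeff, Polynomial.coeff_C_mul, Polynomial.coeff_add,
    Polynomial.coeff_X_pow] at hc
  rw [Finset.sum_eq_single s] at hc
  · rw [if_pos rfl] at hc
    -- For `s = 0` the two monomials coincide and the coefficient is `2 * l s`.
    split_ifs at hc <;> omega
  · intro r _ hr
    have hr' : (r : ℕ) ≠ s := fun h => hr (Fin.ext h)
    have := r.2
    rw [if_neg (by omega), if_neg (by omega)]
    simp
  · simp

theorem neg_one_pow_two_mul_sub {m r : ℕ} (hr : r ≤ 2 * m) :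
    (-1 : ℝ) ^ (2 * m - r) = (-1) ^ r := by
  have h : (-1 : ℝ) ^ (2 * m - r) * (-1) ^ r = 1 := by
    rw [← pow_add, Nat.sub_add_cancel hr, pow_mul]
    simp
  rcases neg_one_pow_eq_or ℝ r with h2 | h2 <;> rw [h2] at h ⊢ <;> linarith

open Filter Topology in
/-- There are times at which all `exp (i t θ)`, with `θ = 2 cos (2π r / 2 ^ (j + 2))` an eigenvalue
of the cycle on `2 ^ (j + 2)` vertices, simultaneously approach `± (-1) ^ r`. -/
theorem exists_tendsto_exp_two_mul_cos (j : ℕ) :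
    ∃ (t : ℕ → ℝ) (η : ℝ), (η = 1 ∨ η = -1) ∧ ∀ r < 2 ^ (j + 2),
      Tendsto (fun i => Complex.exp (Complex.I *
          (t i * (2 * Real.cos (2 * Real.pi * (r : ℕ) / (2 ^ (j + 2) : ℕ))) : ℝ))) atTop
        (𝓝 ((η * (-1) ^ r : ℝ) : ℂ)) := by
  set M := 2 ^ j with hM
  have hM0 : 0 < M := by positivity
  have hN : 2 ^ (j + 2) = 4 * M := by rw [hM]; ring
  -- The offset `M` is forced: the eigenvalue at `r = M` is zero, so its exponential is always 1 and
  -- `η * (-1) ^ M` must be 1.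
  obtain ⟨t, ht⟩ := exists_tendsto_exp_of_linearIndependent (linearIndependent_two_mul_cos j)
    (fun r => Real.pi * (M + (r : ℕ)))
  rw [hN] at ht ⊢
  refine ⟨t, (-1) ^ M, neg_one_pow_eq_or ℝ M, ?_⟩
  let S : ℕ → Prop := fun r => Tendsto (fun i => Complex.exp (Complex.I *
      (t i * (2 * Real.cos (2 * Real.pi * (r : ℕ) / (4 * M : ℕ))) : ℝ))) atTop
    (𝓝 (((-1) ^ M * (-1) ^ r : ℝ) : ℂ))
  have hMr : (M : ℝ) ≠ 0 := by positivity
  have hlow : ∀ r < M, S r := by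
    intro r hr
    have h := ht ⟨r, hr⟩
    have hval : Complex.exp (Complex.I * (Real.pi * (M + (r : ℕ)) : ℝ)) =
        (((-1) ^ M * (-1) ^ r : ℝ) : ℂ) := by
      rw [← pow_add]
      push_cast
      rw [← Complex.exp_pi_mul_I, ← Complex.exp_nat_mul]
      congr 1
      push_cast
      ring
    simp only [hval] at h
    exact h
  have hmid : S M := by
    have h0 : Real.cos (2 * Real.pi * (M : ℕ) / (4 * M : ℕ)) = 0 := by
      rw [show 2 * Real.pi * (M : ℕ) / ((4 * M : ℕ) : ℝ) = Real.pi / 2 by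
        push_cast; field_simp; ring]
      exact Real.cos_pi_div_two
    have h1 : ((-1 : ℝ) ^ M * (-1) ^ M) = 1 := by rw [← mul_pow]; simp
    simp only [S, h0, h1]
    simp
  -- The eigenvalue changes sign, so the limit is inverted; it is `±1`, hence unchanged, and `2 * M
  -- - r` has the parity of `r`.
  have hneg : ∀ r ≤ 2 * M, S r → S (2 * M - r) := by
    intro r hr h
    have hc : Real.cos (2 * Real.pi * ((2 * M - r : ℕ) : ℝ) / (4 * M : ℕ)) =
        -Real.cos (2 * Real.pi * (r : ℕ) / (4 * M : ℕ)) := by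
      rw [← Real.cos_pi_sub]
      congr 1
      push_cast [Nat.cast_sub hr]
      field_simp
      ring
    have hs : ((-1 : ℝ)) ^ (2 * M - r) = (-1) ^ r := by
      exact neg_one_pow_two_mul_sub hr
    have h' := h.inv₀ (by simp)
    simp only [S, hc, hs]
    convert h' using 2
    · rw [← Complex.exp_neg]
      congr 1
      push_cast
      ring
    · rcases neg_one_pow_eq_or ℝ M with h1 | h1 <;> rcases neg_one_pow_eq_or ℝ r with h2 | h2 <;>
        simp [h1, h2]
  have hrefl : ∀ r ≤ 4 * M, S r → S (4 * M - r) := by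
    intro r hr h
    have hc : Real.cos (2 * Real.pi * ((4 * M - r : ℕ) : ℝ) / (4 * M : ℕ)) =
        Real.cos (2 * Real.pi * (r : ℕ) / (4 * M : ℕ)) := by
      rw [← Real.cos_two_pi_sub]
      congr 1
      push_cast [Nat.cast_sub hr]
      field_simp
      ring
    have hs : ((-1 : ℝ)) ^ (4 * M - r) = (-1) ^ r := by
      rw [show 4 * M = 2 * (2 * M) by ring]
      exact neg_one_pow_two_mul_sub (by omega)
    simp only [S, hc, hs]
    exact h
  have hhalf : ∀ r ≤ 2 * M, S r := by
    intro r hr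
    rcases lt_trichotomy r M with h | rfl | h
    · exact hlow r h
    · exact hmid
    · have := hneg (2 * M - r) (by omega) (hlow _ (by omega))
      rwa [show 2 * M - (2 * M - r) = r by omega] at this
  intro r hr
  rcases le_total r (2 * M) with h | h
  · exact hhalf r h
  · have := hrefl (4 * M - r) (by omega) (hhalf _ (by omega))
    rwa [show 4 * M - (4 * M - r) = r by omega] at this

/-! ### Distances and antipodes in a cycle -/

namespace SimpleGraph

theorem cycleGraph_adj_iff_val {N : ℕ} (hN : 2 ≤ N) {u v : Fin N} :
    (cycleGraph N).Adj u v ↔ (u : ℕ) = v + 1 ∨ (u : ℕ) + N = v + 1 ∨ (v : ℕ) = u + 1 ∨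
      (v : ℕ) + N = u + 1 := by
  rw [cycleGraph_adj']
  have key : ∀ x y : Fin N, ((x - y).val = 1 ↔ (x : ℕ) = y + 1 ∨ (x : ℕ) + N = y + 1) := by
    intro x y
    have hx := x.2
    have hy := y.2
    rcases le_or_gt y x with h | h
    · rw [Fin.sub_val_of_le h]
      have : (y : ℕ) ≤ x := h
      omega
    · rw [Fin.coe_sub_iff_lt.2 h]
      have : (x : ℕ) < y := h
      omega
  rw [key, key]
  tauto

/-- The walk follows increasing labels; the second alternative allows one passage through 0. With
the endpoints exchanged it covers the other arc. -/
theorem exists_walk_cycleGraph_length_eq {N : ℕ} (hN : 2 ≤ N) (d : ℕ) (u v : Fin N)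
    (h : (v : ℕ) = u + d ∨ (v : ℕ) + N = u + d) :
    ∃ p : (cycleGraph N).Walk u v, p.length = d := by
  induction d generalizing v with
  | zero =>
    have hu := u.2
    obtain rfl : v = u := Fin.ext (by omega)
    exact ⟨Walk.nil, rfl⟩
  | succ d ih =>
    have hv := v.2
    have hu := u.2
    obtain ⟨w, hw⟩ : ∃ w : Fin N, (v : ℕ) = w + 1 ∨ (v : ℕ) + N = w + 1 := by
      rcases Nat.eq_zero_or_pos (v : ℕ) with h0 | h0
      · exact ⟨⟨N - 1, by omega⟩, Or.inr (by simp only; omega)⟩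
      · exact ⟨⟨v - 1, by omega⟩, Or.inl (by simp only; omega)⟩
    have hw2 := w.2
    by_cases hwu : (w : ℕ) = u + d ∨ (w : ℕ) + N = u + d
    · obtain ⟨p, hp⟩ := ih w hwu
      refine ⟨p.concat ((cycleGraph_adj_iff_val hN).2 (by omega)), ?_⟩
      rw [Walk.length_concat, hp]
    · omega

/-- The circular distance changes by at most one along an edge. The sum of the two truncated
differences is the absolute difference of the labels. -/
theorem min_le_length_cycleGraph_walk {N : ℕ} (hN : 2 ≤ N) {u v : Fin N}
    (p : (cycleGraph N).Walk u v) :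
    min ((u : ℕ) - v + (v - u)) (N - ((u : ℕ) - v + (v - u))) ≤ p.length := by
  induction p with
  | nil => simp
  | @cons u w v h p ih =>
    rw [Walk.length_cons]
    have hu := u.2
    have hv := v.2
    have hw := w.2
    rcases (cycleGraph_adj_iff_val hN).1 h with h | h | h | h <;> omega

end SimpleGraph

/-- Antipodal vertices of an even cycle differ by half of its length. -/
theorem IsAntipodal.val_eq_add_half {h : ℕ} (hh : 1 ≤ h) {a c : Fin (2 * h)}
    (hac : IsAntipodal (SimpleGraph.cycleGraph (2 * h)) a c) :
    (c : ℕ) = a + h ∨ (a : ℕ) = c + h := by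
  have hN : 2 ≤ 2 * h := by omega
  have ha := a.2
  have hc := c.2
  have hconn : (SimpleGraph.cycleGraph (2 * h)).Connected :=
    { preconnected := SimpleGraph.cycleGraph_preconnected, nonempty := ⟨a⟩ }
  have : Nonempty (Fin (2 * h)) := ⟨a⟩
  obtain ⟨b, hb⟩ : ∃ b : Fin (2 * h), (b : ℕ) = a + h ∨ (a : ℕ) = b + h := by
    rcases lt_or_ge (a : ℕ) h with h0 | h0
    · exact ⟨⟨a + h, by omega⟩, Or.inl rfl⟩
    · exact ⟨⟨a - h, by omega⟩, Or.inr (by simp only; omega)⟩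
  -- Only this lower bound is needed: it makes both arcs between `a` and `c` at least `h` long, and
  -- their lengths add up to `2 * h`.
  have hdiam : h ≤ (SimpleGraph.cycleGraph (2 * h)).diam := by
    refine le_trans ?_ (SimpleGraph.dist_le_diam
      (SimpleGraph.connected_iff_ediam_ne_top.1 hconn) (u := a) (v := b))
    obtain ⟨p, hp⟩ := hconn.exists_walk_length_eq_dist a b
    have := SimpleGraph.min_le_length_cycleGraph_walk hN p
    omega
  rw [← hac] at hdiam
  have hle : ∀ d, ((c : ℕ) = a + d ∨ (c : ℕ) + 2 * h = a + d) → h ≤ d := by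
    intro d hd
    obtain ⟨p, hp⟩ := SimpleGraph.exists_walk_cycleGraph_length_eq hN d a c hd
    exact hdiam.trans (hp ▸ SimpleGraph.dist_le p)
  have hle' : ∀ d, ((a : ℕ) = c + d ∨ (a : ℕ) + 2 * h = c + d) → h ≤ d := by
    intro d hd
    obtain ⟨p, hp⟩ := SimpleGraph.exists_walk_cycleGraph_length_eq hN d c a hd
    rw [SimpleGraph.dist_comm] at hdiam
    exact hdiam.trans (hp ▸ SimpleGraph.dist_le p)
  rcases le_total (a : ℕ) c with h1 | h1
  · have := hle (c - a) (by omega)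
    have := hle' (2 * h - (c - a)) (by omega)
    omega
  · have := hle' (a - c) (by omega)
    have := hle (2 * h - (a - c)) (by omega)
    omega

/-! ### Exponentials on eigenvectors, and the Hamiltonians of `K_n - C` -/

/-- An eigenvector of `A` is an eigenvector of `exp (z • A)`. -/
theorem Matrix.exp_smul_mulVec_of_mulVec_eq {V : Type*} [Fintype V] [DecidableEq V]
    {A : Matrix V V ℂ} {x : V → ℂ} {μ : ℂ} (h : A.mulVec x = μ • x) (z : ℂ) :
    (NormedSpace.exp (z • A)).mulVec x = Complex.exp (z * μ) • x := by
  have hpow : ∀ n : ℕ, ((z • A) ^ n).mulVec x = (z * μ) ^ n • x := by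
    intro n
    induction n with
    | zero => simp
    | succ n ih =>
      rw [pow_succ, ← Matrix.mulVec_mulVec, Matrix.smul_mulVec, h, Matrix.mulVec_smul,
        Matrix.mulVec_smul, ih, pow_succ]
      simp only [smul_smul]
      congr 1
      ring
  have h1 : HasSum (fun n : ℕ => ((n.factorial⁻¹ : ℂ) • (z • A) ^ n)) (NormedSpace.exp (z • A)) := by
    open scoped Matrix.Norms.Operator in
    exact NormedSpace.exp_series_hasSum_exp' (𝕂 := ℂ) (z • A)
  have h2 : HasSum (fun n : ℕ => ((n.factorial⁻¹ : ℂ) • (z • A) ^ n).mulVec x)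
      ((NormedSpace.exp (z • A)).mulVec x) :=
    h1.map (Matrix.mulVecBilin ℂ ℂ |>.flip x) (by
      change Continuous fun B : Matrix V V ℂ => B.mulVec x
      fun_prop)
  have h3 : HasSum (fun n : ℕ => ((n.factorial⁻¹ : ℂ) • (z * μ) ^ n)) (Complex.exp (z * μ)) := by
    rw [Complex.exp_eq_exp_ℂ]
    exact NormedSpace.exp_series_hasSum_exp' (𝕂 := ℂ) (z * μ)
  have h4 := h3.smul_const x
  refine h2.unique ?_
  convert h4 using 2 with n
  rw [Matrix.smul_mulVec, hpow, smul_assoc]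

/-- The sum of `g` against the extension by zero of `f`. -/
theorem sum_mul_extend {α β : Type*} [Fintype α] [Fintype β] {φ : α → β}
    (hφ : Function.Injective φ) (g : β → ℂ) (f : α → ℂ) :
    ∑ v, g v * Function.extend φ f 0 v = ∑ s, g (φ s) * f s := by
  symm
  refine Fintype.sum_of_injective φ hφ _ _ (fun v hv => ?_) fun s => ?_
  · rw [Function.extend_apply' _ _ _ (by simpa using hv)]
    simp
  · rw [hφ.extend_apply]

section completeMinusCycle

variable {N n : ℕ} (φ : SimpleGraph.Copy (SimpleGraph.cycleGraph N) (⊤ : SimpleGraph (Fin n)))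

theorem completeMinusCycle_adj_apply (s s' : Fin N) :
    (completeMinusCycle φ).Adj (φ s) (φ s') ↔
      s ≠ s' ∧ ¬ (SimpleGraph.cycleGraph N).Adj s s' := by
  have hφ : Function.Injective φ := φ.injective
  simp only [completeMinusCycle, SimpleGraph.deleteEdges_adj, SimpleGraph.top_adj,
    SimpleGraph.Subgraph.mem_edgeSet, SimpleGraph.Subgraph.map_adj, Relation.Map,
    SimpleGraph.Subgraph.top_adj, hφ.ne_iff]
  refine and_congr_right fun _ => not_congr ⟨?_, fun h => ⟨s, s', h, rfl, rfl⟩⟩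
  rintro ⟨x, y, h, hx, hy⟩
  rwa [← hφ hx, ← hφ hy]

theorem completeMinusCycle_adj_of_notMem_range {u v : Fin n}
    (h : u ∉ Set.range φ ∨ v ∉ Set.range φ) :
    (completeMinusCycle φ).Adj u v ↔ u ≠ v := by
  simp only [completeMinusCycle, SimpleGraph.deleteEdges_adj, SimpleGraph.top_adj,
    SimpleGraph.Subgraph.mem_edgeSet, SimpleGraph.Subgraph.map_adj, Relation.Map,
    SimpleGraph.Subgraph.top_adj, and_iff_left_iff_imp]
  rintro _ ⟨x, y, _, hx, hy⟩
  rcases h with h | h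
  · exact h ⟨x, hx⟩
  · exact h ⟨y, hy⟩

-- A cycle vertex is non-adjacent exactly to itself and its two cycle neighbours, which are distinct
-- because `3 ≤ N`.
open Classical in
theorem completeMinusCycle_degree_apply (hN : 3 ≤ N) (s : Fin N) :
    (((completeMinusCycle φ).degree (φ s) : ℕ) : ℂ) = n - 3 := by
  have hφ : Function.Injective φ := φ.injective
  have hdeg : (SimpleGraph.cycleGraph N).degree s = 2 := by
    obtain ⟨m, rfl⟩ : ∃ m, N = m + 3 := ⟨N - 3, by omega⟩
    convert SimpleGraph.cycleGraph_degree_three_le (n := m) (v := s)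
  have hset : (completeMinusCycle φ).neighborFinset (φ s) ∪
      (insert s ((SimpleGraph.cycleGraph N).neighborFinset s)).image φ = Finset.univ := by
    ext v
    simp only [Finset.mem_union, SimpleGraph.mem_neighborFinset, Finset.mem_image,
      Finset.mem_insert, Finset.mem_univ, iff_true]
    by_cases hv : v ∈ Set.range φ
    · obtain ⟨s', rfl⟩ := hv
      rw [completeMinusCycle_adj_apply]
      by_cases h1 : s' = s
      · exact Or.inr ⟨s', Or.inl h1, rfl⟩
      · by_cases h2 : (SimpleGraph.cycleGraph N).Adj s s'
        · exact Or.inr ⟨s', Or.inr h2, rfl⟩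
        · exact Or.inl ⟨fun h => h1 h.symm, h2⟩
    · rw [completeMinusCycle_adj_of_notMem_range φ (Or.inr hv)]
      exact Or.inl fun h => hv ⟨s, h⟩
  have hdisj : Disjoint ((completeMinusCycle φ).neighborFinset (φ s))
      ((insert s ((SimpleGraph.cycleGraph N).neighborFinset s)).image φ) := by
    rw [Finset.disjoint_left]
    intro v hv hv'
    obtain ⟨s', hs', rfl⟩ := Finset.mem_image.1 hv'
    rw [SimpleGraph.mem_neighborFinset, completeMinusCycle_adj_apply] at hv
    rw [Finset.mem_insert, SimpleGraph.mem_neighborFinset] at hs'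
    rcases hs' with h | h
    · exact hv.1 h.symm
    · exact hv.2 h
  have hcard := congrArg Finset.card hset
  rw [Finset.card_union_of_disjoint hdisj, Finset.card_image_of_injective _ hφ,
    Finset.card_insert_of_notMem (by simp), SimpleGraph.card_neighborFinset_eq_degree,
    SimpleGraph.card_neighborFinset_eq_degree, hdeg, Finset.card_univ, Fintype.card_fin] at hcard
  have hcast : (((completeMinusCycle φ).degree (φ s) : ℕ) : ℂ) + (2 + 1) = n := by
    exact_mod_cast hcard
  linear_combination hcast

open Classical in
/-- On vectors of sum zero supported on the cycle, the adjacency matrix of `K_n - C` acts as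
`-I - A(C)`. -/
theorem completeMinusCycle_adjMatrix_mulVec_extend {f : Fin N → ℂ} (hsum : ∑ s, f s = 0) {θ : ℂ}
    (hf : ∀ s, ∑ s' ∈ (SimpleGraph.cycleGraph N).neighborFinset s, f s' = θ * f s) :
    ((completeMinusCycle φ).adjMatrix ℂ).mulVec (Function.extend φ f 0) =
      (-1 - θ) • Function.extend φ f 0 := by
  have hφ : Function.Injective φ := φ.injective
  funext u
  rw [Matrix.mulVec, dotProduct, sum_mul_extend hφ, Pi.smul_apply, smul_eq_mul]
  simp only [SimpleGraph.adjMatrix_apply]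
  by_cases hu : u ∈ Set.range φ
  · obtain ⟨s, rfl⟩ := hu
    rw [hφ.extend_apply]
    -- All-ones row minus identity row minus cycle row; the first contributes the sum of `f`, which
    -- is zero.
    have : ∀ s', (if (completeMinusCycle φ).Adj (φ s) (φ s') then (1 : ℂ) else 0) * f s' =
        f s' - (if s = s' then f s' else 0) -
          if (SimpleGraph.cycleGraph N).Adj s s' then f s' else 0 := by
      intro s'
      simp only [completeMinusCycle_adj_apply]
      by_cases h1 : s = s'
      · subst h1; simp
      · by_cases h2 : (SimpleGraph.cycleGraph N).Adj s s' <;> simp [h1, h2]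
    simp_rw [this]
    rw [Finset.sum_sub_distrib, Finset.sum_sub_distrib, hsum, Finset.sum_ite_eq,
      if_pos (Finset.mem_univ s), ← Finset.sum_filter]
    have hfil : Finset.univ.filter (fun s' => (SimpleGraph.cycleGraph N).Adj s s') =
        (SimpleGraph.cycleGraph N).neighborFinset s := by
      ext; simp
    rw [hfil, hf]
    ring
  · rw [Function.extend_apply' _ _ _ (by simpa using hu)]
    -- A vertex off the cycle sees all of it, so its entry is the sum of `f` and nothing leaks out
    -- of the cycle.
    have : ∀ s', (if (completeMinusCycle φ).Adj u (φ s') then (1 : ℂ) else 0) * f s' = f s' := by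
      intro s'
      rw [if_pos ((completeMinusCycle_adj_of_notMem_range φ (Or.inl hu)).2
        fun h => hu ⟨s', h.symm⟩), one_mul]
    simp_rw [this, hsum]
    simp

-- Degrees off the cycle do not matter, since the vector vanishes there.
open Classical in
theorem completeMinusCycle_degMatrix_mulVec_extend (hN : 3 ≤ N) (f : Fin N → ℂ) :
    ((completeMinusCycle φ).degMatrix ℂ).mulVec (Function.extend φ f 0) =
      ((n : ℂ) - 3) • Function.extend φ f 0 := by
  have hφ : Function.Injective φ := φ.injective
  funext u
  rw [SimpleGraph.degMatrix_mulVec_apply, Pi.smul_apply, smul_eq_mul]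
  by_cases hu : u ∈ Set.range φ
  · obtain ⟨s, rfl⟩ := hu
    rw [completeMinusCycle_degree_apply φ hN]
  · rw [Function.extend_apply' _ _ _ (by simpa using hu)]
    simp

/-- On vectors of sum zero supported on the cycle, each Hamiltonian of `K_n - C` acts as
`α I ± A(C)`. -/
theorem exists_hamiltonian_completeMinusCycle_mulVec_extend (hN : 3 ≤ N) (m : HamiltonianType) :
    ∃ α σ : ℝ, (σ = 1 ∨ σ = -1) ∧ ∀ (f : Fin N → ℂ) (θ : ℝ), ∑ s, f s = 0 →
      (∀ s, ∑ s' ∈ (SimpleGraph.cycleGraph N).neighborFinset s, f s' = θ * f s) →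
      ((hamiltonian m (completeMinusCycle φ)).map (fun r : ℝ => (r : ℂ))).mulVec
        (Function.extend φ f 0) = ((α + σ * θ : ℝ) : ℂ) • Function.extend φ f 0 := by
  classical
  have hA : ((completeMinusCycle φ).adjMatrix ℝ).map (fun r : ℝ => (r : ℂ)) =
      (completeMinusCycle φ).adjMatrix ℂ := by
    ext u v
    simp only [Matrix.map_apply, SimpleGraph.adjMatrix_apply]
    split_ifs <;> simp
  have hD : ((completeMinusCycle φ).degMatrix ℝ).map (fun r : ℝ => (r : ℂ)) =
      (completeMinusCycle φ).degMatrix ℂ := by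
    ext u v
    simp only [Matrix.map_apply, SimpleGraph.degMatrix, Matrix.diagonal_apply]
    split_ifs <;> simp
  cases m with
  | adjacency =>
    refine ⟨-1, -1, Or.inr rfl, fun f θ hsum hf => ?_⟩
    have h1 := completeMinusCycle_adjMatrix_mulVec_extend φ hsum
      (θ := θ) (fun s => by convert hf s)
    rw [← hA] at h1
    convert h1 using 2
    · congr!
    · push_cast; ring
  | laplacian =>
    -- From `(n - 3) - (-1 - θ)`; the signless case below uses the sum instead.
    refine ⟨n - 2, 1, Or.inl rfl, fun f θ hsum hf => ?_⟩
    have h1 := completeMinusCycle_adjMatrix_mulVec_extend φ hsum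
      (θ := θ) (fun s => by convert hf s)
    have h2 := completeMinusCycle_degMatrix_mulVec_extend φ hN f
    have hH : (hamiltonian .laplacian (completeMinusCycle φ)).map (fun r : ℝ => (r : ℂ)) =
        (completeMinusCycle φ).degMatrix ℂ - (completeMinusCycle φ).adjMatrix ℂ := by
      rw [← hA, ← hD, ← Matrix.map_sub _ (by intros; push_cast; ring)]
      simp only [hamiltonian]
    rw [hH, Matrix.sub_mulVec, h1, h2, ← sub_smul]
    congr 1
    push_cast; ring
  | signlessLaplacian =>
    refine ⟨n - 4, -1, Or.inr rfl, fun f θ hsum hf => ?_⟩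
    have h1 := completeMinusCycle_adjMatrix_mulVec_extend φ hsum
      (θ := θ) (fun s => by convert hf s)
    have h2 := completeMinusCycle_degMatrix_mulVec_extend φ hN f
    have hH : (hamiltonian .signlessLaplacian (completeMinusCycle φ)).map (fun r : ℝ => (r : ℂ)) =
        (completeMinusCycle φ).degMatrix ℂ + (completeMinusCycle φ).adjMatrix ℂ := by
      rw [← hA, ← hD, ← Matrix.map_add _ (by intros; push_cast; ring)]
      simp only [hamiltonian]
    rw [hH, Matrix.add_mulVec, h1, h2, ← add_smul]
    congr 1
    push_cast; ring

end completeMinusCycle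

/-! ### Fourier analysis on `ℤ/N` -/

/-- The characters of `ℤ/N` are eigenvectors of the cycle. -/
theorem sum_neighborFinset_cycleGraph_pow {N : ℕ} (hN : 3 ≤ N) {z : ℂ} (hz : z ^ N = 1)
    (s : Fin N) :
    ∑ s' ∈ (SimpleGraph.cycleGraph N).neighborFinset s, z ^ (s' : ℕ) =
      (z + z⁻¹) * z ^ (s : ℕ) := by
  obtain ⟨m, rfl⟩ : ∃ m, N = m + 3 := ⟨N - 3, by omega⟩
  have hz0 : z ≠ 0 := by
    rintro rfl
    simp at hz
  have hsucc : ∀ w : Fin (m + 3), z ^ ((w + 1 : Fin (m + 3)) : ℕ) = z * z ^ (w : ℕ) := by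
    intro w
    rw [Fin.val_add, ← pow_eq_pow_mod _ hz, Fin.val_one, pow_succ, mul_comm]
  have hpred : z ^ (s : ℕ) = z * z ^ ((s - 1 : Fin (m + 3)) : ℕ) := by
    rw [← hsucc, sub_add_cancel]
  -- Were they equal, the pair of neighbours would be a singleton, against degree 2.
  have hne : s - 1 ≠ s + 1 := by
    have hc := SimpleGraph.cycleGraph_degree_three_le (n := m) (v := s)
    rw [SimpleGraph.cycleGraph_degree_two_le] at hc
    intro h
    rw [h] at hc
    simp at hc
  rw [SimpleGraph.cycleGraph_neighborFinset, Finset.sum_pair hne, hsucc, hpred]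
  field_simp
  ring

/-- Fourier inversion on `ℤ/N`, for vectors supported on an embedded copy of `ℤ/N`. -/
theorem single_eq_sum_extend_pow {V : Type*} [DecidableEq V] {N : ℕ} {ζ : ℂ}
    (hζ : IsPrimitiveRoot ζ N) {φ : Fin N → V} (hφ : Function.Injective φ) (a : Fin N) :
    (Pi.single (φ a) 1 : V → ℂ) = ∑ r ∈ Finset.range N,
      ((N : ℂ)⁻¹ * ζ ^ (r * (N - a))) • Function.extend φ (fun s => (ζ ^ r) ^ (s : ℕ)) 0 := by
  have hN0 : (N : ℂ) ≠ 0 := by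
    have := a.2
    exact_mod_cast (by omega : N ≠ 0)
  funext v
  rw [Finset.sum_apply]
  simp only [Pi.smul_apply, smul_eq_mul]
  by_cases hv : v ∈ Set.range φ
  · obtain ⟨s, rfl⟩ := hv
    simp only [hφ.extend_apply]
    -- `N - a` stands for `-a` in the exponent, so the sum over `r` is geometric with ratio `ζ ^ (s
    -- - a)`.
    have hterm : ∀ r, (N : ℂ)⁻¹ * ζ ^ (r * (N - a)) * (ζ ^ r) ^ (s : ℕ) =
        (N : ℂ)⁻¹ * (ζ ^ (N - a + s : ℕ)) ^ r := by
      intro r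
      rw [mul_assoc, ← pow_mul, ← pow_mul, ← pow_add]
      congr 2
      ring
    simp_rw [hterm, ← Finset.mul_sum]
    by_cases hsa : s = a
    · subst hsa
      have h1 : ζ ^ (N - s + s : ℕ) = 1 := by
        rw [Nat.sub_add_cancel s.2.le, hζ.pow_eq_one]
      simp_rw [h1]
      simp [hN0]
    · have hne : ζ ^ (N - a + s : ℕ) ≠ 1 := by
        rw [Ne, hζ.pow_eq_one_iff_dvd]
        rintro ⟨q, hq⟩
        have h1 := a.2
        have h2 := s.2
        have h3 : (s : ℕ) ≠ a := fun h => hsa (Fin.ext h)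
        have hq1 : 0 < q := by
          rcases Nat.eq_zero_or_pos q with rfl | h
          · omega
          · exact h
        have hq2 : q < 2 := by
          by_contra! h
          have := Nat.mul_le_mul_left N h
          omega
        obtain rfl : q = 1 := by omega
        omega
      have hgeom : ∑ r ∈ Finset.range N, (ζ ^ (N - a + s : ℕ)) ^ r = 0 := by
        have h := mul_geom_sum (ζ ^ (N - a + s : ℕ)) N
        rw [← pow_mul, mul_comm _ N, pow_mul, hζ.pow_eq_one, one_pow, sub_self] at h
        exact (mul_eq_zero.1 h).resolve_left (sub_ne_zero.2 hne)
      rw [hgeom, mul_zero, Pi.single_eq_of_ne (hφ.ne hsa)]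
  · rw [Pi.single_eq_of_ne (fun h => hv ⟨a, h.symm⟩)]
    symm
    refine Finset.sum_eq_zero fun r _ => ?_
    rw [Function.extend_apply' _ _ _ (by simpa using hv)]
    simp

/-! ### Pair states and the transfer -/

theorem isRealPureState_pairState {V : Type*} [Fintype V] [DecidableEq V] {a b : V} (h : a ≠ b) :
    IsRealPureState (pairState a b) := by
  have key : ∀ v, pairState a b v ^ 2 = (Pi.single a (1 / 2) + Pi.single b (1 / 2) : V → ℝ) v := by
    intro v
    have h2 : (Real.sqrt 2)⁻¹ ^ 2 = 1 / 2 := by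
      rw [inv_pow, Real.sq_sqrt (by norm_num)]; norm_num
    by_cases ha : v = a
    · subst ha
      simp [pairState, h, h2]
    · by_cases hb : v = b
      · subst hb
        simp [pairState, ha, h2]
      · simp [pairState, ha, hb]
  unfold IsRealPureState
  simp_rw [key, Pi.add_apply, Finset.sum_add_distrib]
  simp
  norm_num

open Filter Topology in
/-- Pretty good state transfer between antipodal pair states of `K_n - C`, for a cycle `C` whose
length is a power of two. -/
theorem prettyGoodStateTransfer_completeMinusCycle {N n j : ℕ} (hNj : N = 2 ^ (j + 2))
    (φ : SimpleGraph.Copy (SimpleGraph.cycleGraph N) (⊤ : SimpleGraph (Fin n)))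
    (a b c d : Fin N) (hab : a ≠ b)
    (hac : IsAntipodal (SimpleGraph.cycleGraph N) a c)
    (hbd : IsAntipodal (SimpleGraph.cycleGraph N) b d)
    (m : HamiltonianType) :
    PrettyGoodStateTransfer (hamiltonian m (completeMinusCycle φ))
      (pairState (φ a) (φ b)) (pairState (φ c) (φ d)) := by
  have hφ : Function.Injective φ := φ.injective
  obtain ⟨h, hh, hh1⟩ : ∃ h, N = 2 * h ∧ 2 ≤ h :=
    ⟨2 ^ (j + 1), by rw [hNj]; ring, by
      rw [pow_succ]
      have := Nat.one_le_two_pow (n := j)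
      omega⟩
  have hN3 : 3 ≤ N := by omega
  have hac' : (c : ℕ) = a + h ∨ (a : ℕ) = c + h := by
    subst hh
    exact hac.val_eq_add_half (by omega)
  have hbd' : (d : ℕ) = b + h ∨ (b : ℕ) = d + h := by
    subst hh
    exact hbd.val_eq_add_half (by omega)
  have hcd : c ≠ d := by
    intro hcd
    have h1 : (c : ℕ) = d := by rw [hcd]
    have h2 := a.2
    have h3 := b.2
    have h4 := c.2
    have h5 : (a : ℕ) ≠ b := fun h => hab (Fin.ext h)
    omega
  refine ⟨isRealPureState_pairState (hφ.ne hab), isRealPureState_pairState (hφ.ne hcd), ?_⟩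
  have hN0 : N ≠ 0 := by omega
  set ζ : ℂ := Complex.exp (2 * Real.pi * Complex.I / N) with hζdef
  have hζ : IsPrimitiveRoot ζ N := Complex.isPrimitiveRoot_exp N hN0
  let w : ℕ → Fin n → ℂ := fun r => Function.extend φ (fun s : Fin N => (ζ ^ r) ^ (s : ℕ)) 0
  let θ : ℕ → ℝ := fun r => 2 * Real.cos (2 * Real.pi * (r : ℕ) / N)
  let e : Fin N → ℕ → ℂ := fun a r => (N : ℂ)⁻¹ * ζ ^ (r * (N - a))
  let κ : Fin N → Fin N → ℕ → ℂ := fun a b r => (1 / Real.sqrt 2 : ℝ) * (e a r - e b r)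
  have hstate : ∀ a b : Fin N, (fun v => ((pairState (φ a) (φ b) v : ℝ) : ℂ)) =
      ∑ r ∈ Finset.range N, κ a b r • w r := by
    intro a b
    have h1 : (fun v => ((pairState (φ a) (φ b) v : ℝ) : ℂ)) =
        ((1 / Real.sqrt 2 : ℝ) : ℂ) • ((Pi.single (φ a) 1 : Fin n → ℂ) - Pi.single (φ b) 1) := by
      funext v
      simp only [pairState, Pi.smul_apply, Pi.sub_apply, smul_eq_mul, Pi.single_apply]
      split_ifs <;> push_cast <;> rfl
    rw [h1, single_eq_sum_extend_pow hζ hφ, single_eq_sum_extend_pow hζ hφ,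
      ← Finset.sum_sub_distrib, Finset.smul_sum]
    refine Finset.sum_congr rfl fun r _ => ?_
    rw [← sub_smul, smul_smul]
  -- The constant mode has nonzero sum, so the eigenvalue formula is unavailable for it; it cancels
  -- in a pair state.
  have hκ0 : ∀ a b, κ a b 0 = 0 := by
    intro a b
    simp [κ, e]
  obtain ⟨α, σ, hσ, hham⟩ := exists_hamiltonian_completeMinusCycle_mulVec_extend φ hN3 m
  have heig : ∀ r < N, r ≠ 0 →
      ((hamiltonian m (completeMinusCycle φ)).map (fun r : ℝ => (r : ℂ))).mulVec (w r) =
        ((α + σ * θ r : ℝ) : ℂ) • w r := by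
    intro r hr hr0
    have hpow : (ζ ^ r) ^ N = 1 := by
      rw [← pow_mul, mul_comm, pow_mul, hζ.pow_eq_one, one_pow]
    refine hham _ _ ?_ fun s => ?_
    · have hne : ζ ^ r ≠ 1 := hζ.pow_ne_one_of_pos_of_lt hr0 hr
      rw [Fin.sum_univ_eq_sum_range (fun s => (ζ ^ r) ^ s)]
      have h := mul_geom_sum (ζ ^ r) N
      rw [hpow, sub_self] at h
      exact (mul_eq_zero.1 h).resolve_left (sub_ne_zero.2 hne)
    · have := sum_neighborFinset_cycleGraph_pow hN3 hpow s
      convert this using 2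
      simp only [θ]
      push_cast
      rw [Complex.two_cos, hζdef, ← Complex.exp_nat_mul, ← Complex.exp_neg]
      congr 2 <;> ring
  obtain ⟨t, η, hη, ht⟩ := exists_tendsto_exp_two_mul_cos j
  rw [← hNj] at ht
  -- The limit of the common phase is irrelevant, so no arithmetic condition on `α` is needed.
  obtain ⟨g, hg, ψ, hψ, hlim⟩ := (isCompact_sphere (0 : ℂ) 1).tendsto_subseq
    (x := fun i => Complex.exp (Complex.I * (t i * α : ℝ))) (fun i => by
      rw [mem_sphere_zero_iff_norm, mul_comm, Complex.norm_exp_ofReal_mul_I])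
  have hphase : ∀ r < N, Tendsto (fun i => Complex.exp (Complex.I * (t (ψ i) : ℂ) *
      ((α + σ * θ r : ℝ) : ℂ))) atTop (𝓝 (g * ((η * (-1) ^ r : ℝ) : ℂ))) := by
    intro r hr
    have h1 : Tendsto (fun i => Complex.exp (Complex.I * (t (ψ i) * θ r : ℝ))) atTop
        (𝓝 ((η * (-1) ^ r : ℝ) : ℂ)) := (ht r hr).comp hψ.tendsto_atTop
    have h2 : Tendsto (fun i => Complex.exp (Complex.I * (t (ψ i) * (σ * θ r) : ℝ))) atTop
        (𝓝 ((η * (-1) ^ r : ℝ) : ℂ)) := by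
      rcases hσ with rfl | rfl
      · simpa only [one_mul] using h1
      -- A sign `σ = -1` inverts the exponential, and the limit `±1` is its own inverse.
      · have h' := h1.inv₀ (by rcases hη with rfl | rfl <;> simp)
        convert h' using 2
        · rw [← Complex.exp_neg]
          congr 1
          push_cast
          ring
        · rcases hη with rfl | rfl <;> rcases neg_one_pow_eq_or ℝ r with h3 | h3 <;> simp [h3]
    refine (hlim.mul h2).congr fun i => ?_
    rw [Function.comp_apply, ← Complex.exp_add]
    congr 1
    push_cast
    ring
  have hζh : ζ ^ h = -1 := by
    have h1 : (ζ ^ h) ^ 2 = 1 := by rw [← pow_mul, mul_comm, ← hh, hζ.pow_eq_one]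
    rcases sq_eq_sq_iff_eq_or_eq_neg.1 (h1.trans (one_pow 2).symm) with h2 | h2
    · exact absurd h2 (hζ.pow_ne_one_of_pos_of_lt (by omega) (by omega))
    · exact h2
  -- A half turn multiplies the `r`-th coefficient by a power of `ζ ^ h = -1`.
  have hshift : ∀ x y : Fin N, (y : ℕ) = x + h → ∀ r, e x r = (-1) ^ r * e y r := by
    intro x y hxy r
    have hy := y.2
    simp only [e]
    rw [show r * (N - x) = h * r + r * (N - y) by
      rw [show N - (x : ℕ) = h + (N - y) by omega]; ring, pow_add, pow_mul, hζh]
    ring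
  have hanti : ∀ x y : Fin N, ((y : ℕ) = x + h ∨ (x : ℕ) = y + h) →
      ∀ r, e x r * (-1) ^ r = e y r := by
    intro x y hxy r
    have hs : ((-1 : ℂ) ^ r) * (-1) ^ r = 1 := by rw [← mul_pow]; simp
    rcases hxy with hxy | hxy
    · rw [hshift x y hxy]
      linear_combination e y r * hs
    · rw [hshift y x hxy]
      ring
  have hκ : ∀ r, κ a b r * (-1) ^ r = κ c d r := by
    intro r
    simp only [κ]
    rw [← hanti a c hac', ← hanti b d hbd']
    ring
  refine ⟨t ∘ ψ, g * η, ?_, ?_⟩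
  · rw [norm_mul, mem_sphere_zero_iff_norm.1 hg]
    rcases hη with rfl | rfl <;> simp
  · have hU : ∀ i, (transitionMatrix (hamiltonian m (completeMinusCycle φ)) ((t ∘ ψ) i)).mulVec
        (fun v => ((pairState (φ a) (φ b) v : ℝ) : ℂ)) =
        ∑ r ∈ Finset.range N, (κ a b r * Complex.exp (Complex.I * (t (ψ i) : ℂ) *
          ((α + σ * θ r : ℝ) : ℂ))) • w r := by
      intro i
      rw [hstate, Matrix.mulVec_sum]
      refine Finset.sum_congr rfl fun r hr => ?_
      by_cases hr0 : r = 0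
      · subst hr0
        simp [hκ0]
      · rw [Matrix.mulVec_smul, transitionMatrix,
          Matrix.exp_smul_mulVec_of_mulVec_eq (heig r (Finset.mem_range.1 hr) hr0), smul_smul]
        rfl
    simp_rw [hU]
    have hsum := tendsto_finsetSum (Finset.range N) fun r hr =>
      ((hphase r (Finset.mem_range.1 hr)).const_mul (κ a b r)).smul_const (w r)
    convert hsum using 2
    rw [hstate, Finset.smul_sum]
    refine Finset.sum_congr rfl fun r _ => ?_
    rw [smul_smul, ← hκ]
    congr 1
    push_cast
    ring

theorem theorem5p3 (k n : ℕ) (hk : 2 ≤ k) (hn : 2 ^ k ≤ n)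
    (φ : SimpleGraph.Copy (SimpleGraph.cycleGraph (2 ^ k)) (⊤ : SimpleGraph (Fin n)))
    (a b c d : Fin (2 ^ k)) (hab : a ≠ b)
    (hac : IsAntipodal (SimpleGraph.cycleGraph (2 ^ k)) a c)
    (hbd : IsAntipodal (SimpleGraph.cycleGraph (2 ^ k)) b d)
    (m : HamiltonianType) :
    PrettyGoodStateTransfer (hamiltonian m (completeMinusCycle φ))
      (pairState (φ a) (φ b)) (pairState (φ c) (φ d)) :=
  prettyGoodStateTransfer_completeMinusCycle (j := k - 2) (by rw [Nat.sub_add_cancel hk])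
    φ a b c d hab hac hbd m
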